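/- Let $P(X)=a_dX^d+\cdots+a_0\in\mathbb Z[X]$ with $d\ge 1$, $a_d\ge 1$, satisfy: (i) $\gcd(a_d,\ldots,a_0)=1$ and $a_0\neq 0$; (ii) $P$ has no multiple roots; (iii) every irreducible factor of $P$ in $\mathbb Z[X]$ has at least one complex root of modulus greater than $1$. Let $\alpha_1,\ldots,\alpha_p$ be the (distinct) complex roots of $P$ of modulus greater than $1$. For an integer $k\ge 0$ let $\Xi_k$ be the set of tuples $\mathbf g=(g_1,\ldots,g_p)$ of polynomials in $\mathbb C[X]$ of degree at most $k$ such that $g_i\in\mathbb R[X]$ whenever $\alpha_i\in\mathbb R$, and $g_j=\overline{g_i}$ (coefficientwise conjugation) whenever $\alpha_j=\overline{\alpha_i}$. For $\mathbf g\in\Xi_k$ put $$x_n(\mathbf g)=\sum_{i=1}^p g_i(n)\alpha_i^n\in\mathbb R\qquad(n\in\mathbb Z),$$ and let $$\mathcal L^{(k)}(P)=\Bigl\{\limsup_{n\to\infty}\|x_n(\mathbf g)\| \;:\; \mathbf g\in\Xi_k\Bigr\},$$ where $\|x\|$ is the distance from $x\in\mathbb R$ to the nearest integer. Call $P$ hyperbolic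 if no complex root of $P$ has modulus $1$. **Theorem.** Suppose in addition that $P$ is monic, and let $k\ge 0$ be an integer. Then $0$ is an isolated point of $\mathcal L^{(k)}(P)$ if and only if $P$ is hyperbolic. Moreover, if $P$ is not hyperbolic, then $\mathcal L^{(k)}(P)$ is a dense subset of $[0,1/2]$. -/

import Mathlib

open Polynomial Filter Set

noncomputable section

namespace MarkoffLagrange

/-- The distance from a real number to the nearest integer. -/
def distInt (x : ℝ) : ℝ := |x - round x|

/-- The complex roots of an integer polynomial, each listed once. -/
def rootSetC (P : ℤ[X]) : Finset ℂ := (P.map (Int.castRingHom ℂ)).roots.toFinset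

/-- The expanding roots, i.e. the complex roots of modulus greater than one. -/
def expandingRoots (P : ℤ[X]) : Finset ℂ := (rootSetC P).filter (fun z => 1 < ‖z‖)

/-- The standing assumptions on the integer polynomial `P`: it has degree at least one, positive
leading coefficient, coprime coefficients, nonzero constant term, no multiple root, and every
irreducible factor of it in `ℤ[X]` has a root of modulus greater than one. -/
structure Admissible (P : ℤ[X]) : Prop where
  one_le_natDegree : 1 ≤ P.natDegree
  one_le_leadingCoeff : 1 ≤ P.leadingCoeff
  isPrimitive : P.IsPrimitive
  coeff_zero_ne_zero : P.coeff 0 ≠ 0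
  nodup_roots : (P.map (Int.castRingHom ℂ)).roots.Nodup
  exists_expanding_root :
    ∀ Q : ℤ[X], Irreducible Q → Q ∣ P → ∃ z : ℂ, aeval z Q = 0 ∧ 1 < ‖z‖

/-- `P` is hyperbolic when no complex root of it lies on the unit circle. -/
def Hyperbolic (P : ℤ[X]) : Prop := ∀ z ∈ rootSetC P, ‖z‖ ≠ 1

/-- The coefficient families: one complex polynomial of degree at most `k` for each expanding root,
with real coefficients at the real roots, and with conjugate polynomials at conjugate roots. The
family is written as a function on `ℂ`; its values off the expanding roots are never used. -/
def coeffFamilies (P : ℤ[X]) (k : ℕ) : Set (ℂ → ℂ[X]) :=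
  {g | ∀ α ∈ expandingRoots P,
      (g α).degree ≤ (k : WithBot ℕ) ∧
      (α.im = 0 → ∃ q : ℝ[X], g α = q.map Complex.ofRealHom) ∧
      g (starRingEnd ℂ α) = (g α).map (starRingEnd ℂ)}

/-- The sum of `g_α(n) α ^ n` over the expanding roots `α`, as a complex number. -/
def recSumC (P : ℤ[X]) (g : ℂ → ℂ[X]) (n : ℤ) : ℂ :=
  ∑ α ∈ expandingRoots P, (g α).eval (n : ℂ) * α ^ n

/-- The bi-infinite real sequence `x_n(g)`. Taking the real part loses nothing,
see `coe_recSeq`. -/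
def recSeq (P : ℤ[X]) (g : ℂ → ℂ[X]) (n : ℤ) : ℝ := (recSumC P g n).re

/-- The spectrum: all values of `limsup ‖x_n(g)‖` as `n → ∞`, where `‖·‖` is the distance to the
nearest integer and `g` runs over the coefficient families of degree at most `k`. -/
def spectrumL (P : ℤ[X]) (k : ℕ) : Set ℝ :=
  {t | ∃ g ∈ coeffFamilies P k,
      t = limsup (fun n : ℕ => distInt (recSeq P g (n : ℤ))) atTop}

/-- `x` is an isolated point of the set `S` of reals: it lies in `S` and some neighbourhood of it
contains no other point of `S`. -/
def IsIsolatedPoint (x : ℝ) (S : Set ℝ) : Prop :=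
  x ∈ S ∧ ∃ ε > 0, ∀ y ∈ S, |y - x| < ε → y = x

/-- `A` is a dense subset of the set `B` of reals. -/
def IsDenseIn (A B : Set ℝ) : Prop := A ⊆ B ∧ B ⊆ closure A

theorem conj_mem_rootSetC {P : ℤ[X]} {z : ℂ} (hz : z ∈ rootSetC P) :
    starRingEnd ℂ z ∈ rootSetC P := by
  simp only [rootSetC, Multiset.mem_toFinset, mem_roots', IsRoot.def] at hz ⊢
  refine ⟨hz.1, ?_⟩
  have h := congrArg (starRingEnd ℂ) hz.2
  rw [← eval_map_apply, Polynomial.map_map] at h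
  simpa [RingHom.ext_int ((starRingEnd ℂ).comp (Int.castRingHom ℂ)) (Int.castRingHom ℂ)] using h

theorem conj_mem_expandingRoots {P : ℤ[X]} {z : ℂ} (hz : z ∈ expandingRoots P) :
    starRingEnd ℂ z ∈ expandingRoots P := by
  simp only [expandingRoots, Finset.mem_filter] at hz ⊢
  exact ⟨conj_mem_rootSetC hz.1, by simpa using hz.2⟩

/-- For a coefficient family the defining sum is real. -/
theorem coe_recSeq {P : ℤ[X]} {k : ℕ} {g : ℂ → ℂ[X]} (hg : g ∈ coeffFamilies P k) (n : ℤ) :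
    ((recSeq P g n : ℝ) : ℂ) = recSumC P g n := by
  have h : starRingEnd ℂ (recSumC P g n) = recSumC P g n := by
    unfold recSumC
    rw [map_sum]
    refine Finset.sum_nbij' (starRingEnd ℂ) (starRingEnd ℂ)
      (fun _ h => conj_mem_expandingRoots h) (fun _ h => conj_mem_expandingRoots h)
      (by simp) (by simp) ?_
    intro α hα
    rw [(hg α hα).2.2, map_mul, map_zpow₀, ← eval_map_apply]
    simp
  exact Complex.conj_eq_iff_re.mp h

end MarkoffLagrange

end

open scoped Topology

noncomputable section

namespace MarkoffLagrange

/-! Write x_n = u_n + e_n with u_n the nearest integer, and let T be the shift. Since P(T)^(k+1)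
kills x, the sequence P(T)^(k+1) e is integer-valued; if e is eventually small, it is eventually 0.
In the hyperbolic case e is then a bounded solution of a recurrence with no characteristic root on
the unit circle, so e tends to 0: this is the gap above 0 (`exists_gap_of_hyperbolic`).

If P has roots of modulus 1, take the constants c_β = β^h - 1. Over all roots, the sum of c_β β^n is
a difference of power sums, an integer because P is monic. The expanding part is therefore an
integer minus the unit-circle part minus a part tending to 0. A suitable h makes every c_β with |β|
= 1 small; none vanishes, as P has no root of unity among its roots. So the error has a limsup L
that is positive and as small as desired (`exists_small_error`), and the multiples mL < 1/2 lie in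
the spectrum. -/

/-! ### The shift operator on complex sequences -/

/-- The shift `(y_n) ↦ (y_{n+1})` on complex sequences. -/
def shiftEnd : Module.End ℂ (ℕ → ℂ) := LinearMap.funLeft ℂ ℂ Nat.succ

theorem shiftEnd_apply (y : ℕ → ℂ) (n : ℕ) : shiftEnd y n = y (n + 1) := rfl

theorem shiftEnd_pow_apply (i : ℕ) (y : ℕ → ℂ) (n : ℕ) : (shiftEnd ^ i) y n = y (n + i) := by
  induction i generalizing n with
  | zero => simp
  | succ i ih => rw [pow_succ', Module.End.mul_apply, shiftEnd_apply, ih]; congr 1; ring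

theorem aeval_shiftEnd_apply (p : ℂ[X]) (y : ℕ → ℂ) (n : ℕ) :
    aeval shiftEnd p y n = ∑ i ∈ Finset.range (p.natDegree + 1), p.coeff i * y (n + i) := by
  simp [aeval_eq_sum_range, shiftEnd_pow_apply]

theorem aeval_shiftEnd_X_sub_C_apply (a : ℂ) (y : ℕ → ℂ) (n : ℕ) :
    aeval shiftEnd (X - C a) y n = y (n + 1) - a * y n := by
  simp [shiftEnd_apply, Module.algebraMap_end_apply]

theorem tendsto_aeval_shiftEnd (p : ℂ[X]) {y : ℕ → ℂ} (hy : Tendsto y atTop (𝓝 0)) :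
    Tendsto (aeval shiftEnd p y) atTop (𝓝 0) := by
  have h : aeval shiftEnd p y =
      fun n => ∑ i ∈ Finset.range (p.natDegree + 1), p.coeff i * y (n + i) :=
    funext (aeval_shiftEnd_apply p y)
  rw [h, show (0 : ℂ) = ∑ i ∈ Finset.range (p.natDegree + 1), p.coeff i * 0 by simp]
  exact tendsto_finsetSum _ fun i _ => ((tendsto_add_atTop_iff_nat i).2 hy).const_mul _

theorem norm_aeval_shiftEnd_le (p : ℂ[X]) {y : ℕ → ℂ} {B : ℝ} {n : ℕ}
    (hy : ∀ i, n ≤ i → ‖y i‖ ≤ B) :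
    ‖aeval shiftEnd p y n‖ ≤ (∑ i ∈ Finset.range (p.natDegree + 1), ‖p.coeff i‖) * B := by
  rw [aeval_shiftEnd_apply, Finset.sum_mul]
  refine norm_sum_le_of_le _ fun i _ => ?_
  rw [norm_mul]
  exact mul_le_mul_of_nonneg_left (hy _ (Nat.le_add_right _ _)) (norm_nonneg _)

theorem aeval_shiftEnd_pow (p : ℂ[X]) (c z : ℂ) (n : ℕ) :
    aeval shiftEnd p (fun n => c * z ^ n) n = c * p.eval z * z ^ n := by
  rw [aeval_shiftEnd_apply, eval_eq_sum_range, Finset.mul_sum, Finset.sum_mul]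
  refine Finset.sum_congr rfl fun i _ => ?_
  ring

/-- `(T - α) ^ m` kills `q(n) α ^ n` when `deg q < m`. -/
theorem aeval_shiftEnd_X_sub_C_pow_eq_zero (α : ℂ) (m : ℕ) (q : ℂ[X]) (hq : q.degree < m) :
    aeval shiftEnd ((X - C α) ^ m) (fun n : ℕ => q.eval (n : ℂ) * α ^ n) = 0 := by
  induction m generalizing q with
  | zero =>
    have : q = 0 := by
      rw [← degree_eq_bot]; simpa using hq
    subst this
    simp [Pi.zero_def]
  | succ m ih =>
    rw [pow_succ, map_mul, Module.End.mul_apply]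
    -- One factor replaces q by α times its forward difference, whose degree is lower.
    have h : aeval shiftEnd (X - C α) (fun n : ℕ => q.eval (n : ℂ) * α ^ n) =
        fun n : ℕ => (C α * (taylor 1 q - q)).eval (n : ℂ) * α ^ n := by
      funext n
      rw [aeval_shiftEnd_X_sub_C_apply]
      simp only [eval_mul, eval_C, eval_sub, taylor_eval, Nat.cast_add, Nat.cast_one]
      rw [add_comm (n : ℂ) 1]
      ring
    rw [h]
    apply ih
    by_cases hq0 : q = 0
    · simp [hq0, bot_lt_iff_ne_bot]
    · rw [← smul_eq_C_mul]
      refine lt_of_le_of_lt (degree_smul_le α (taylor 1 q - q)) ?_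
      have h1 : (taylor 1 q - q).degree < q.degree :=
        (degree_sub_lt_left (by simp) (by simpa using hq0) (by simp)).trans_eq (by simp)
      have h2 : q.degree ≤ m := by
        rw [degree_eq_natDegree hq0] at hq ⊢
        exact_mod_cast Nat.lt_succ_iff.1 (by exact_mod_cast hq)
      exact h1.trans_le h2

/-! ### Bounded solutions of linear recurrences without characteristic roots of modulus one -/

theorem tendsto_zero_of_norm_limsup_le {y : ℕ → ℂ} {B : ℝ} (hB : ∀ n, ‖y n‖ ≤ B)
    (h : limsup (fun n => ‖y n‖) atTop ≤ 0) : Tendsto y atTop (𝓝 0) := by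
  rw [Metric.tendsto_nhds]
  intro ε hε
  have := eventually_lt_of_limsup_lt (h.trans_lt hε) (isBoundedUnder_of ⟨B, hB⟩)
  simpa [dist_zero_right] using this

/-- In the limit the relation scales L = limsup ‖y n‖ by ‖a‖, so a finite L must be 0. Boundedness
is essential when ‖a‖ > 1: it excludes a^n. -/
theorem tendsto_zero_of_sub_mul_tendsto_zero {a : ℂ} (ha : ‖a‖ ≠ 1) {y : ℕ → ℂ} {B : ℝ}
    (hB : ∀ n, ‖y n‖ ≤ B) (h : Tendsto (fun n => y (n + 1) - a * y n) atTop (𝓝 0)) :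
    Tendsto y atTop (𝓝 0) := by
  refine tendsto_zero_of_norm_limsup_le hB ?_
  set L := limsup (fun n => ‖y n‖) atTop with hL
  have hbdd : IsBoundedUnder (· ≤ ·) atTop fun n => ‖y n‖ := isBoundedUnder_of ⟨B, hB⟩
  have hcob : IsCoboundedUnder (· ≤ ·) atTop fun n => ‖y n‖ :=
    (isBoundedUnder_of ⟨0, fun n => norm_nonneg _⟩ :
      IsBoundedUnder (· ≥ ·) atTop fun n => ‖y n‖).isCoboundedUnder_le
  have key : ∀ ε > 0, ∀ᶠ n in atTop,
      ‖y n‖ < L + ε ∧ ‖y (n + 1)‖ < L + ε ∧ ‖y (n + 1) - a * y n‖ < ε := by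
    intro ε hε
    have h1 : ∀ᶠ n in atTop, ‖y n‖ < L + ε := eventually_lt_of_limsup_lt (by linarith) hbdd
    have h2 := (tendsto_add_atTop_nat 1).eventually h1
    have h3 : ∀ᶠ n in atTop, ‖y (n + 1) - a * y n‖ < ε := by
      simpa [dist_zero_right] using Metric.tendsto_nhds.1 h ε hε
    filter_upwards [h1, h2, h3] with n h1 h2 h3 using ⟨h1, h2, h3⟩
  by_contra! hpos
  rcases lt_or_gt_of_ne ha with ha | ha
  · have : ∀ ε > 0, L ≤ ‖a‖ * L + (‖a‖ + 1) * ε := by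
      intro ε hε
      refine (limsup_nat_add (fun n => ‖y n‖) 1).symm.trans_le ?_
      refine limsup_le_of_le (u := fun n => ‖y (n + 1)‖) ?_ ?_
      · exact (isBoundedUnder_of ⟨0, fun n => norm_nonneg _⟩ :
          IsBoundedUnder (· ≥ ·) atTop fun n => ‖y (n + 1)‖).isCoboundedUnder_le
      · filter_upwards [key ε hε] with n hn
        have h1 : ‖y (n + 1)‖ ≤ ‖y (n + 1) - a * y n‖ + ‖a‖ * ‖y n‖ := by
          rw [← norm_mul]
          simpa using norm_add_le (y (n + 1) - a * y n) (a * y n)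
        nlinarith [norm_nonneg a, hn.1, hn.2.2]
    have h2 := this ((1 - ‖a‖) * L / 4) (by nlinarith)
    nlinarith [norm_nonneg a, mul_pos (sub_pos.2 ha) hpos]
  · have : ∀ ε > 0, L ≤ (L + 2 * ε) / ‖a‖ := by
      intro ε hε
      refine limsup_le_of_le hcob ?_
      filter_upwards [key ε hε] with n hn
      have h1 : ‖a‖ * ‖y n‖ ≤ ‖y (n + 1)‖ + ‖y (n + 1) - a * y n‖ := by
        rw [← norm_mul]
        simpa using norm_sub_le (y (n + 1)) (y (n + 1) - a * y n)
      rw [le_div_iff₀ (by linarith)]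
      linarith [hn.2.1, hn.2.2]
    have h2 := this ((‖a‖ - 1) * L / 4) (by nlinarith)
    rw [le_div_iff₀ (by linarith)] at h2
    nlinarith [mul_pos (sub_pos.2 ha) hpos]

theorem tendsto_zero_of_aeval_shiftEnd (s : Multiset ℂ) (hs : ∀ a ∈ s, ‖a‖ ≠ 1) {y : ℕ → ℂ}
    {B : ℝ} (hB : ∀ n, ‖y n‖ ≤ B)
    (h : Tendsto (aeval shiftEnd (s.map fun a => X - C a).prod y) atTop (𝓝 0)) :
    Tendsto y atTop (𝓝 0) := by
  induction s using Multiset.induction with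
  | empty => simpa using h
  | cons a s ih =>
    refine ih (fun b hb => hs b (Multiset.mem_cons_of_mem hb)) ?_
    rw [Multiset.map_cons, Multiset.prod_cons, map_mul, Module.End.mul_apply] at h
    refine tendsto_zero_of_sub_mul_tendsto_zero (hs a (Multiset.mem_cons_self a s))
      (fun n => norm_aeval_shiftEnd_le _ fun i _ => hB i) ?_
    simpa only [← aeval_shiftEnd_X_sub_C_apply] using h

/-! ### Elementary facts on the distance to the nearest integer and on the roots -/

theorem distInt_nonneg (x : ℝ) : 0 ≤ distInt x := abs_nonneg _

theorem distInt_le_half (x : ℝ) : distInt x ≤ 1 / 2 := abs_sub_round x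

theorem distInt_intCast_add (m : ℤ) (x : ℝ) : distInt (m + x) = distInt x := by
  simp [distInt, round_intCast_add]

theorem distInt_eq_abs {x : ℝ} (hx : |x| < 1 / 2) : distInt x = |x| := by
  have : round x = 0 := by
    rw [round_eq_zero_iff]
    rw [abs_lt] at hx
    constructor <;> linarith
  simp [distInt, this]

theorem isBoundedUnder_distInt (x : ℕ → ℝ) :
    IsBoundedUnder (· ≤ ·) atTop fun n => distInt (x n) :=
  isBoundedUnder_of ⟨_, fun n => distInt_le_half (x n)⟩

theorem isCoboundedUnder_of_nonneg {x : ℕ → ℝ} (hx : ∀ n, 0 ≤ x n) :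
    IsCoboundedUnder (· ≤ ·) atTop x :=
  (isBoundedUnder_of ⟨0, hx⟩ : IsBoundedUnder (· ≥ ·) atTop x).isCoboundedUnder_le

theorem spectrumL_subset_Icc (P : ℤ[X]) (k : ℕ) : spectrumL P k ⊆ Icc 0 (1 / 2) := by
  rintro t ⟨g, -, rfl⟩
  constructor
  · exact le_limsup_of_frequently_le (Frequently.of_forall fun n => distInt_nonneg _)
      (isBoundedUnder_distInt _)
  · exact limsup_le_of_le (isCoboundedUnder_of_nonneg fun n => distInt_nonneg _)
      (Eventually.of_forall fun n => distInt_le_half _)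

theorem zero_mem_spectrumL (P : ℤ[X]) (k : ℕ) : 0 ∈ spectrumL P k := by
  refine ⟨0, fun α _ => ⟨by simp, fun _ => ⟨0, by simp⟩, by simp⟩, ?_⟩
  simp [recSeq, recSumC, distInt]

theorem mem_rootSetC {P : ℤ[X]} (hP : P ≠ 0) {z : ℂ} : z ∈ rootSetC P ↔ aeval z P = 0 := by
  have : P.map (Int.castRingHom ℂ) ≠ 0 :=
    (Polynomial.map_ne_zero_iff (RingHom.injective_int _)).2 hP
  simp [rootSetC, this, eval_map, aeval_def]

/-! ### The hyperbolic case -/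

theorem aeval_shiftEnd_recSumC {P : ℤ[X]} {k : ℕ} {g : ℂ → ℂ[X]} (hg : g ∈ coeffFamilies P k) :
    aeval shiftEnd ((P.map (Int.castRingHom ℂ)) ^ (k + 1)) (fun n : ℕ => recSumC P g n) = 0 := by
  have h : (fun n : ℕ => recSumC P g n) =
      ∑ α ∈ expandingRoots P, fun n : ℕ => (g α).eval (n : ℂ) * α ^ n := by
    funext n
    simp [recSumC]
  rw [h, map_sum]
  refine Finset.sum_eq_zero fun α hα => ?_
  have hroot : (P.map (Int.castRingHom ℂ)).IsRoot α := by
    simp only [expandingRoots, rootSetC, Finset.mem_filter, Multiset.mem_toFinset] at hα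
    exact isRoot_of_mem_roots hα.1
  obtain ⟨q, hq⟩ := pow_dvd_pow_of_dvd (dvd_iff_isRoot.2 hroot) (k + 1)
  rw [hq, mul_comm, map_mul, Module.End.mul_apply, aeval_shiftEnd_X_sub_C_pow_eq_zero, map_zero]
  exact lt_of_le_of_lt (hg α hα).1 (by exact_mod_cast Nat.lt_succ_self k)

theorem exists_int_aeval_shiftEnd (Q : ℤ[X]) (u : ℕ → ℤ) (n : ℕ) :
    ∃ m : ℤ, aeval shiftEnd (Q.map (Int.castRingHom ℂ)) (fun n => (u n : ℂ)) n = m := by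
  rw [aeval_shiftEnd_apply]
  refine ⟨∑ i ∈ Finset.range ((Q.map (Int.castRingHom ℂ)).natDegree + 1), Q.coeff i * u (n + i), ?_⟩
  push_cast
  simp

theorem exists_gap_of_hyperbolic {P : ℤ[X]} (hmonic : P.Monic) (hyp : Hyperbolic P) (k : ℕ) :
    ∃ ε > 0, ∀ t ∈ spectrumL P k, |t - 0| < ε → t = 0 := by
  set PC := P.map (Int.castRingHom ℂ) with hPC
  have hPCm : PC.Monic := hmonic.map _
  -- Errors of size at most 1/(A+1) give ‖P(T)^(k+1) e‖ ≤ A/(A+1) < 1, which forces the integer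
  -- value to be 0.
  set A := ∑ i ∈ Finset.range ((PC ^ (k + 1)).natDegree + 1), ‖(PC ^ (k + 1)).coeff i‖ with hA
  have hA0 : 0 ≤ A := Finset.sum_nonneg fun _ _ => norm_nonneg _
  refine ⟨1 / (A + 1), by positivity, ?_⟩
  rintro t ⟨g, hg, rfl⟩ ht
  rw [sub_zero] at ht
  set x : ℕ → ℝ := fun n => recSeq P g n with hx
  set e : ℕ → ℂ := fun n => ((x n - round (x n) : ℝ) : ℂ) with he
  have hnorm : ∀ n, ‖e n‖ = distInt (x n) := fun n => by
    simp only [he, distInt, Complex.norm_real, Real.norm_eq_abs]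
  have hdec : e = (fun n : ℕ => recSumC P g n) - fun n => ((round (x n) : ℤ) : ℂ) := by
    funext n
    simp [he, hx, ← coe_recSeq hg]
  have hQe : aeval shiftEnd (PC ^ (k + 1)) e =
      - aeval shiftEnd (PC ^ (k + 1)) (fun n => ((round (x n) : ℤ) : ℂ)) := by
    rw [hdec, map_sub, aeval_shiftEnd_recSumC hg, zero_sub]
  have hev : ∀ᶠ n in atTop, distInt (x n) < 1 / (A + 1) :=
    eventually_lt_of_limsup_lt ((le_abs_self _).trans_lt ht) (isBoundedUnder_distInt _)
  obtain ⟨N, hN⟩ := eventually_atTop.1 hev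
  have hzero : ∀ n ≥ N, aeval shiftEnd (PC ^ (k + 1)) e n = 0 := by
    intro n hn
    have h1 := norm_aeval_shiftEnd_le (PC ^ (k + 1)) (y := e) (B := 1 / (A + 1)) (n := n)
      fun i hi => by rw [hnorm]; exact (hN i (hn.trans hi)).le
    obtain ⟨m, hm⟩ := exists_int_aeval_shiftEnd (P ^ (k + 1)) (fun n => round (x n)) n
    rw [Polynomial.map_pow, ← hPC] at hm
    have h2 : A * (1 / (A + 1)) < 1 := by
      rw [mul_one_div, div_lt_one (by positivity)]; linarith
    have h3 := h1.trans_lt h2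
    rw [hQe, Pi.neg_apply, hm] at h3 ⊢
    rw [norm_neg, Complex.norm_intCast] at h3
    have : m = 0 := Int.abs_lt_one_iff.1 (by exact_mod_cast h3)
    simp [this]
  have hprod : PC ^ (k + 1) = (((k + 1) • PC.roots).map fun a => X - C a).prod := by
    rw [Multiset.map_nsmul, Multiset.prod_nsmul,
      ← (IsAlgClosed.splits PC).eq_prod_roots_of_monic hPCm]
  have hlim : Tendsto e atTop (𝓝 0) := by
    refine tendsto_zero_of_aeval_shiftEnd ((k + 1) • PC.roots) (fun a ha => ?_)
      (B := 1 / 2) (fun n => (hnorm n).trans_le (distInt_le_half _)) ?_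
    · refine hyp a ?_
      rw [Multiset.mem_nsmul] at ha
      simpa [rootSetC] using ha.2
    · rw [← hprod]
      exact tendsto_const_nhds.congr' (eventually_atTop.2 ⟨N, fun n hn => (hzero n hn).symm⟩)
  have := hlim.norm
  simp only [hnorm, norm_zero] at this
  exact this.limsup_eq

/-! ### Power sums of the roots -/

theorem esymm_roots_mem_range {P : ℤ[X]} (hmonic : P.Monic) (n : ℕ) :
    (P.map (Int.castRingHom ℂ)).roots.esymm n ∈ (Int.castRingHom ℂ).range := by
  set PC := P.map (Int.castRingHom ℂ) with hPC
  have hPCm : PC.Monic := hmonic.map _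
  have hcard : Multiset.card PC.roots = PC.natDegree :=
    splits_iff_card_roots.1 (IsAlgClosed.splits PC)
  rcases le_or_gt n PC.natDegree with hn | hn
  · have h := coeff_eq_esymm_roots_of_card hcard (Nat.sub_le PC.natDegree n)
    rw [hPCm.leadingCoeff, one_mul, Nat.sub_sub_self hn] at h
    have h2 : PC.roots.esymm n = (-1) ^ n * PC.coeff (PC.natDegree - n) := by
      rw [h, ← mul_assoc, ← mul_pow]; simp
    rw [h2]
    refine Subring.mul_mem _ (Subring.pow_mem _ (Subring.neg_mem _ (Subring.one_mem _)) _) ?_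
    exact ⟨P.coeff (PC.natDegree - n), by simp [hPC]⟩
  · rw [Multiset.esymm, Multiset.powersetCard_eq_empty _ (by omega)]
    simp

/-- Newton's identities express power sums through elementary symmetric functions without division,
and the latter are integers by Vieta. -/
theorem exists_int_sum_pow {P : ℤ[X]} (hmonic : P.Monic)
    (hnodup : (P.map (Int.castRingHom ℂ)).roots.Nodup) (n : ℕ) :
    ∃ m : ℤ, ∑ β ∈ rootSetC P, β ^ n = m := by
  let f : {x // x ∈ rootSetC P} → ℂ := Subtype.val
  have hval : (Finset.univ : Finset {x // x ∈ rootSetC P}).val.map f =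
      (P.map (Int.castRingHom ℂ)).roots := by
    have : (Finset.univ : Finset {x // x ∈ rootSetC P}) = (rootSetC P).attach := rfl
    rw [this, Finset.attach_val, Multiset.attach_map_val, rootSetC, Multiset.toFinset_val,
      hnodup.dedup]
  have hes : ∀ n, MvPolynomial.aeval f (MvPolynomial.esymm {x // x ∈ rootSetC P} ℤ n) ∈
      (Int.castRingHom ℂ).range := fun n => by
    rw [MvPolynomial.aeval_esymm_eq_multiset_esymm, hval]
    exact esymm_roots_mem_range hmonic n
  have hps : ∀ n, MvPolynomial.aeval f (MvPolynomial.psum {x // x ∈ rootSetC P} ℤ n) ∈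
      (Int.castRingHom ℂ).range := fun n => by
    induction n using Nat.strong_induction_on with
    | _ n ih =>
      rcases Nat.eq_zero_or_pos n with rfl | hn
      · rw [MvPolynomial.psum_zero, map_natCast]
        exact natCast_mem _ _
      · rw [MvPolynomial.psum_eq_mul_esymm_sub_sum _ _ n hn, map_sub, map_sum]
        have h1 : ∀ j, (MvPolynomial.aeval f) ((-1 : MvPolynomial {x // x ∈ rootSetC P} ℤ) ^ j) ∈
            (Int.castRingHom ℂ).range := fun j => by
          simpa using Subring.pow_mem (Int.castRingHom ℂ).range (Subring.neg_mem _ (Subring.one_mem _)) j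
        refine Subring.sub_mem _ ?_ (Subring.sum_mem _ fun a ha => ?_)
        · rw [map_mul, map_mul, map_natCast]
          exact Subring.mul_mem _ (Subring.mul_mem _ (h1 _) (natCast_mem _ _)) (hes _)
        · rw [map_mul, map_mul]
          refine Subring.mul_mem _ (Subring.mul_mem _ (h1 _) (hes _)) (ih _ ?_)
          rw [Finset.mem_filter, Finset.HasAntidiagonal.mem_antidiagonal] at ha
          have h2 := ha.2.1
          omega
  obtain ⟨m, hm⟩ := hps n
  refine ⟨m, ?_⟩
  rw [← Finset.sum_attach]
  simpa [MvPolynomial.psum, f] using hm.symm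

/-! ### Roots on the unit circle -/

/-- The minimal polynomial of a root of unity divides X^h - 1, so all its roots have modulus 1; as
an irreducible factor of P it must have an expanding root. -/
theorem pow_ne_one_of_mem_rootSetC {P : ℤ[X]} (hP : Admissible P) (hmonic : P.Monic) {β : ℂ}
    (hβ : β ∈ rootSetC P) {h : ℕ} (hh : 0 < h) : β ^ h ≠ 1 := by
  intro hone
  have hroot : aeval β P = 0 := (mem_rootSetC hmonic.ne_zero).1 hβ
  have hint : IsIntegral ℤ β := ⟨P, hmonic, by simpa [aeval_def] using hroot⟩
  obtain ⟨z, hz, hz1⟩ := hP.exists_expanding_root (minpoly ℤ β) (minpoly.irreducible hint)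
    (minpoly.isIntegrallyClosed_dvd hint hroot)
  obtain ⟨q, hq⟩ := minpoly.isIntegrallyClosed_dvd hint
    (show aeval β (X ^ h - 1 : ℤ[X]) = 0 by simp [hone])
  have hzh : z ^ h = 1 := by
    have := congrArg (aeval z) hq
    rw [map_mul, hz, zero_mul] at this
    simpa [sub_eq_zero] using this
  have : ‖z‖ = 1 := by
    refine (pow_eq_one_iff_of_nonneg (norm_nonneg z) hh.ne').1 ?_
    rw [← norm_pow, hzh, norm_one]
  linarith

/-- By compactness two of the vectors (β^n) are close; dividing by the smaller power, of modulus 1,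
gives h. -/
theorem exists_pow_near_one (s : Finset ℂ) (hs : ∀ β ∈ s, ‖β‖ = 1) {δ : ℝ} (hδ : 0 < δ) :
    ∃ h : ℕ, 0 < h ∧ ∀ β ∈ s, ‖β ^ h - 1‖ < δ := by
  let x : ℕ → (s → ℂ) := fun n β => (β : ℂ) ^ n
  have hx : ∀ n, x n ∈ Metric.closedBall (0 : s → ℂ) 1 := fun n => by
    rw [mem_closedBall_zero_iff, pi_norm_le_iff_of_nonneg zero_le_one]
    intro β
    simp [x, hs β β.2]
  obtain ⟨a, -, φ, hφ, hlim⟩ := tendsto_subseq_of_bounded Metric.isBounded_closedBall hx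
  obtain ⟨N, hN⟩ := Metric.cauchySeq_iff'.1 hlim.cauchySeq δ hδ
  have hlt : φ N < φ (N + 1) := hφ N.lt_succ_self
  refine ⟨φ (N + 1) - φ N, Nat.sub_pos_of_lt hlt, fun β hβ => ?_⟩
  have h1 := (dist_le_pi_dist _ _ (⟨β, hβ⟩ : s)).trans_lt (hN (N + 1) N.le_succ)
  simp only [x, Function.comp_apply, dist_eq_norm] at h1
  have h2 : β ^ φ (N + 1) - β ^ φ N = β ^ φ N * (β ^ (φ (N + 1) - φ N) - 1) := by
    rw [mul_sub, mul_one, ← pow_add, Nat.add_sub_cancel' hlt.le]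
  rwa [h2, norm_mul, norm_pow, hs β hβ, one_pow, one_mul] at h1

/-- A polynomial in the shift vanishing at the other frequencies isolates one term, whose modulus is
constant in n. -/
theorem eq_zero_of_tendsto_sum_pow {s : Finset ℂ} (hs : ∀ β ∈ s, ‖β‖ = 1) {c : ℂ → ℂ}
    (h : Tendsto (fun n : ℕ => ∑ β ∈ s, c β * β ^ n) atTop (𝓝 0)) {β : ℂ} (hβ : β ∈ s) :
    c β = 0 := by
  set R : ℂ[X] := ∏ γ ∈ s.erase β, (X - C γ) with hR
  have hRβ : R.eval β ≠ 0 := by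
    rw [hR, eval_prod, Finset.prod_ne_zero_iff]
    intro γ hγ
    simpa [sub_eq_zero] using (Finset.ne_of_mem_erase hγ).symm
  have hRγ : ∀ γ ∈ s, γ ≠ β → R.eval γ = 0 := by
    intro γ hγ hne
    rw [hR, eval_prod]
    exact Finset.prod_eq_zero (Finset.mem_erase.2 ⟨hne, hγ⟩) (by simp)
  have heq : aeval shiftEnd R (fun n : ℕ => ∑ β ∈ s, c β * β ^ n) =
      fun n => c β * R.eval β * β ^ n := by
    have h1 : (fun n : ℕ => ∑ β ∈ s, c β * β ^ n) = ∑ β ∈ s, fun n : ℕ => c β * β ^ n := by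
      funext n; simp
    funext n
    rw [h1, map_sum, Finset.sum_apply, Finset.sum_eq_single_of_mem β hβ]
    · exact aeval_shiftEnd_pow _ _ _ _
    · intro γ hγ hne
      rw [aeval_shiftEnd_pow, hRγ γ hγ hne]
      ring
  have h2 := tendsto_aeval_shiftEnd R h
  rw [heq] at h2
  have h3 := h2.norm
  simp only [norm_mul, norm_pow, hs β hβ, one_pow, mul_one, norm_zero] at h3
  have h4 := tendsto_nhds_unique h3 tendsto_const_nhds
  simpa [hRβ] using h4.symm

/-! ### The non-hyperbolic case -/

theorem const_mem_coeffFamilies (P : ℤ[X]) (k : ℕ) {c : ℂ → ℂ}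
    (hc : ∀ z, c (starRingEnd ℂ z) = starRingEnd ℂ (c z)) :
    (fun z => C (c z)) ∈ coeffFamilies P k := by
  intro α _
  refine ⟨degree_C_le.trans (by exact_mod_cast Nat.zero_le k), fun him => ?_, by simp [hc]⟩
  have h : starRingEnd ℂ (c α) = c α := by rw [← hc, Complex.conj_eq_iff_im.2 him]
  obtain ⟨r, hr⟩ := Complex.conj_eq_iff_real.1 h
  exact ⟨C r, by simp [hr]⟩

theorem recSumC_const (P : ℤ[X]) (c : ℂ → ℂ) (n : ℕ) :
    recSumC P (fun z => C (c z)) n = ∑ α ∈ expandingRoots P, c α * α ^ n := by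
  simp [recSumC]

/-- For a non-hyperbolic `P` some coefficient family of constants gives a sequence which differs
from an integer sequence by an error whose limit superior is positive and arbitrarily small. -/
theorem exists_small_error {P : ℤ[X]} (hP : Admissible P) (hmonic : P.Monic)
    (hyp : ¬ Hyperbolic P) {δ : ℝ} (hδ : 0 < δ) :
    ∃ (c : ℂ → ℂ) (u : ℕ → ℤ) (e : ℕ → ℝ) (B : ℝ),
      (∀ z, c (starRingEnd ℂ z) = starRingEnd ℂ (c z)) ∧
      (∀ n : ℕ, ∑ α ∈ expandingRoots P, c α * α ^ n = ((u n + e n : ℝ) : ℂ)) ∧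
      (∀ n, |e n| ≤ B) ∧ 0 < limsup (fun n => |e n|) atTop ∧
      limsup (fun n => |e n|) atTop < δ := by
  set U := (rootSetC P).filter (fun z => ‖z‖ = 1) with hU
  set D := (rootSetC P).filter (fun z => ‖z‖ < 1) with hD
  have hU1 : ∀ β ∈ U, ‖β‖ = 1 := fun β hβ => (Finset.mem_filter.1 hβ).2
  have hD1 : ∀ β ∈ D, ‖β‖ < 1 := fun β hβ => (Finset.mem_filter.1 hβ).2
  obtain ⟨h, hh, hclose⟩ := exists_pow_near_one U hU1
    (show 0 < δ / (2 * (U.card + 1)) by positivity)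
  let c : ℂ → ℂ := fun z => z ^ h - 1
  have hc : ∀ z, c (starRingEnd ℂ z) = starRingEnd ℂ (c z) := fun z => by simp [c]
  choose v hv using exists_int_sum_pow hmonic hP.nodup_roots
  let u : ℕ → ℤ := fun n => v (n + h) - v n
  let x : ℕ → ℝ := fun n => recSeq P (fun z => C (c z)) n
  have hx : ∀ n, (x n : ℂ) = ∑ α ∈ expandingRoots P, c α * α ^ n := fun n => by
    rw [← recSumC_const, ← coe_recSeq (const_mem_coeffFamilies P 0 hc)]
  have hu : ∀ n, (u n : ℂ) = ∑ β ∈ rootSetC P, c β * β ^ n := fun n => by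
    simp only [u, Int.cast_sub, ← hv, ← Finset.sum_sub_distrib, c]
    refine Finset.sum_congr rfl fun β _ => ?_
    ring
  let e : ℕ → ℝ := fun n => x n - u n
  let S : ℕ → ℂ := fun n => ∑ β ∈ U, c β * β ^ n
  let W : ℕ → ℂ := fun n => ∑ β ∈ D, c β * β ^ n
  have he : ∀ n, (e n : ℂ) = -(S n + W n) := fun n => by
    have hsplit : ∑ β ∈ rootSetC P, c β * β ^ n =
        ∑ β ∈ expandingRoots P, c β * β ^ n + (S n + W n) := by
      simp only [S, W, hU, hD, expandingRoots, Finset.sum_filter, ← Finset.sum_add_distrib]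
      refine Finset.sum_congr rfl fun β _ => ?_
      rcases lt_trichotomy ‖β‖ 1 with h | h | h
      · simp [h, h.ne, h.not_gt]
      · simp [h]
      · simp [h, h.ne', h.not_gt]
    simp only [e, Complex.ofReal_sub, Complex.ofReal_intCast, hx, hu, hsplit]
    ring
  have hW : Tendsto W atTop (𝓝 0) := by
    rw [show (0 : ℂ) = ∑ β ∈ D, c β * 0 by simp]
    exact tendsto_finsetSum _ fun β hβ =>
      (tendsto_pow_atTop_nhds_zero_of_norm_lt_one (hD1 β hβ)).const_mul _
  have hS : ∀ n, ‖S n‖ ≤ δ / 2 := fun n => by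
    have h1 : ‖S n‖ ≤ ∑ β ∈ U, δ / (2 * (U.card + 1)) :=
      norm_sum_le_of_le _ fun β hβ => by
        rw [norm_mul, norm_pow, hU1 β hβ, one_pow, mul_one]
        exact (hclose β hβ).le
    rw [Finset.sum_const, nsmul_eq_mul] at h1
    refine h1.trans ?_
    rw [← mul_div_assoc, div_le_div_iff₀ (by positivity) (by positivity)]
    nlinarith
  have hen : ∀ n, |e n| = ‖S n + W n‖ := fun n => by
    rw [← norm_neg, ← he, Complex.norm_real, Real.norm_eq_abs]
  obtain ⟨B, hB⟩ := (Metric.isBounded_range_of_tendsto W hW).exists_norm_le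
  have hbound : ∀ n, |e n| ≤ δ / 2 + B := fun n => by
    rw [hen]
    exact norm_add_le_of_le (hS n) (hB _ ⟨n, rfl⟩)
  refine ⟨c, u, e, δ / 2 + B, hc, fun n => ?_, hbound, ?_, ?_⟩
  · rw [← hx]
    simp [e]
  · by_contra! hle
    have h1 : Tendsto (fun n => (e n : ℂ)) atTop (𝓝 0) :=
      tendsto_zero_of_norm_limsup_le (B := δ / 2 + B) (by simpa using hbound) (by simpa using hle)
    have h2 : Tendsto S atTop (𝓝 0) := by
      have := (h1.add hW).neg
      simp only [he, add_zero, neg_zero] at this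
      refine this.congr fun n => ?_
      ring
    simp only [Hyperbolic, not_forall, not_not] at hyp
    obtain ⟨β, hβ, hβ1⟩ := hyp
    have h3 := eq_zero_of_tendsto_sum_pow hU1 h2 (Finset.mem_filter.2 ⟨hβ, hβ1⟩)
    exact pow_ne_one_of_mem_rootSetC hP hmonic hβ hh (sub_eq_zero.1 h3)
  · refine lt_of_le_of_lt (b := 3 / 4 * δ) (limsup_le_of_le
      (isCoboundedUnder_of_nonneg fun n => abs_nonneg _) ?_) (by linarith)
    have hWs : ∀ᶠ n in atTop, ‖W n‖ < δ / 4 := by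
      simpa [dist_zero_right] using Metric.tendsto_nhds.1 hW (δ / 4) (by positivity)
    filter_upwards [hWs] with n hn
    rw [hen]
    linarith [norm_add_le (S n) (W n), hS n]

/-- Natural multiples of the limit superior of an error stay in the spectrum below `1 / 2`. -/
theorem nat_mul_limsup_mem_spectrumL {P : ℤ[X]} (k : ℕ) {c : ℂ → ℂ} {u : ℕ → ℤ} {e : ℕ → ℝ}
    {B : ℝ} (hc : ∀ z, c (starRingEnd ℂ z) = starRingEnd ℂ (c z))
    (hsum : ∀ n : ℕ, ∑ α ∈ expandingRoots P, c α * α ^ n = ((u n + e n : ℝ) : ℂ))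
    (hB : ∀ n, |e n| ≤ B) (m : ℕ) (hm : m * limsup (fun n => |e n|) atTop < 1 / 2) :
    m * limsup (fun n => |e n|) atTop ∈ spectrumL P k := by
  have hmap : m * limsup (fun n => |e n|) atTop = limsup (fun n => m * |e n|) atTop :=
    Monotone.map_limsup_of_continuousAt (f := fun t : ℝ => m * t)
      (fun a b hab => mul_le_mul_of_nonneg_left hab m.cast_nonneg) _
      (by fun_prop) (isBoundedUnder_of ⟨B, hB⟩) (isCoboundedUnder_of_nonneg fun n => abs_nonneg _)
  refine ⟨fun z => C (m * c z), const_mem_coeffFamilies P k (by simp [hc]), ?_⟩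
  rw [hmap] at hm ⊢
  have hbdd : IsBoundedUnder (· ≤ ·) atTop fun n => m * |e n| :=
    isBoundedUnder_of ⟨m * B, fun n => mul_le_mul_of_nonneg_left (hB n) m.cast_nonneg⟩
  refine limsup_congr ?_
  -- Eventually m|e_n| < 1/2, so the nearest integer to the scaled term is m u_n.
  filter_upwards [eventually_lt_of_limsup_lt hm hbdd] with n hn
  have h1 : recSeq P (fun z => C (m * c z)) n = ((m * u n : ℤ) : ℝ) + m * e n := by
    rw [recSeq, recSumC_const]
    simp only [mul_assoc, ← Finset.mul_sum, hsum]
    rw [← Complex.ofReal_natCast, ← Complex.ofReal_mul, Complex.ofReal_re]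
    push_cast
    ring
  have h2 : |m * e n| = m * |e n| := by rw [abs_mul, Nat.abs_cast]
  rw [h1, distInt_intCast_add, distInt_eq_abs (h2 ▸ hn), h2]

theorem Icc_subset_closure_spectrumL {P : ℤ[X]} (hP : Admissible P) (hmonic : P.Monic)
    (hyp : ¬ Hyperbolic P) (k : ℕ) : Icc (0 : ℝ) (1 / 2) ⊆ closure (spectrumL P k) := by
  rintro t ⟨ht0, ht1⟩
  rcases ht0.eq_or_lt with rfl | ht0
  · exact subset_closure (zero_mem_spectrumL P k)
  rw [Metric.mem_closure_iff]
  intro δ hδ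
  obtain ⟨c, u, e, B, hc, hsum, hB, hpos, hlt⟩ := exists_small_error hP hmonic hyp hδ
  set L := limsup (fun n => |e n|) atTop
  -- The largest m with mL < t; strictness keeps mL below 1/2 even for t = 1/2.
  obtain ⟨m, hm⟩ : ∃ m : ℕ, ⌈t / L⌉₊ = m + 1 :=
    Nat.exists_eq_succ_of_ne_zero (Nat.ceil_pos.2 (div_pos ht0 hpos)).ne'
  have h1 : m * L < t := by
    rw [← lt_div_iff₀ hpos, ← Nat.lt_ceil, hm]
    exact m.lt_succ_self
  have h2 : t ≤ (m + 1) * L := by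
    rw [← div_le_iff₀ hpos]
    exact (Nat.le_ceil _).trans_eq (by rw [hm]; push_cast; rfl)
  refine ⟨m * L, nat_mul_limsup_mem_spectrumL k hc hsum hB m (h1.trans_le ht1), ?_⟩
  rw [Real.dist_eq, abs_of_pos (by linarith)]
  linarith

theorem not_isIsolatedPoint_of_dense {S : Set ℝ} (hS : Icc (0 : ℝ) (1 / 2) ⊆ closure S) :
    ¬ IsIsolatedPoint 0 S := by
  rintro ⟨-, ε, hε, h⟩
  -- A point within r of r lies strictly between 0 and 2r ≤ ε.
  set r := min ε (1 / 2) / 2 with hr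
  have hmin : 0 < min ε (1 / 2) := lt_min hε (by norm_num)
  have hr0 : 0 < r := by positivity
  have hrε : 2 * r ≤ ε := by rw [hr]; linarith [min_le_left ε (1 / 2)]
  have hr2 : 2 * r ≤ 1 / 2 := by rw [hr]; linarith [min_le_right ε (1 / 2)]
  obtain ⟨y, hy, hyr⟩ := Metric.mem_closure_iff.1 (hS ⟨hr0.le, by linarith⟩) r hr0
  rw [Real.dist_eq, abs_lt] at hyr
  have := h y hy (by rw [sub_zero, abs_lt]; constructor <;> linarith)
  linarith

end MarkoffLagrange

end

theorem theorem4p2 (P : Polynomial ℤ) (hP : MarkoffLagrange.Admissible P) (hmonic : P.Monic)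
    (k : ℕ) :
    (MarkoffLagrange.IsIsolatedPoint 0 (MarkoffLagrange.spectrumL P k) ↔
      MarkoffLagrange.Hyperbolic P) ∧
    (¬ MarkoffLagrange.Hyperbolic P →
      MarkoffLagrange.IsDenseIn (MarkoffLagrange.spectrumL P k) (Set.Icc (0 : ℝ) (1 / 2))) := by
  refine ⟨⟨fun h => ?_, fun h => ⟨MarkoffLagrange.zero_mem_spectrumL P k,
    MarkoffLagrange.exists_gap_of_hyperbolic hmonic h k⟩⟩, fun h =>
    ⟨MarkoffLagrange.spectrumL_subset_Icc P k,
      MarkoffLagrange.Icc_subset_closure_spectrumL hP hmonic h k⟩⟩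
  by_contra hyp
  exact MarkoffLagrange.not_isIsolatedPoint_of_dense
    (MarkoffLagrange.Icc_subset_closure_spectrumL hP hmonic hyp k) h
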